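/- Let $A=\begin{pmatrix}1&1\\0&1\end{pmatrix}$ and $B=\begin{pmatrix}1&0\\-1&1\end{pmatrix}$, regarded as elements of $\mathrm{PSL}(2,\mathbb Z)$, and for $l\in\mathbb N$ let $B(l)\subset\mathrm{PSL}(2,\mathbb Z)$ be the set of vertices of the ball of radius $l$ centred at $1$ in the Cayley graph of $\mathrm{PSL}(2,\mathbb Z)$ with generators $A^{\pm1},B^{\pm1}$. Let $X$ be the Farey graph: its vertex set is $\mathbb Q\cup\{\infty\}$ (with $\infty=\frac10$), and two reduced fractions $\frac pq,\frac rs$ are adjacent if and only if $|ps-qr|=1$; the group $\mathrm{PSL}(2,\mathbb Z)$ acts on $X$ by Möbius transformations. Let $P=\frac01$. An element $g$ acts loxodromically on $X$ if $\lim_{n\to\infty}\frac1n d_X(P,g^n.P)$ exists and is positive. A geodesic axis of such a $g$ is a bi-infinite geodesic in $X$ joining the two limit points at infinity of the orbit $(g^n.P)_{n\in\mathbb Z}$, that is, lying at finite Hausdorff distance from this orbit. We say that the axis of $g$ passes within distance $1$ of $P$ if $g$ has a geodesic axis on which it acts as a translation, and every geodesic axis of $g$ contains a vertex at distance at most $1$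 from $P$. Then $$\liminf_{l\to\infty}\frac{\#\{g\in B(l)\;:\; g\text{ acts loxodromically on }X\text{ and its axis passes within distance }1\text{ of }P\}}{\#B(l)}>0.$$ -/

import Mathlib

open Filter Topology
open scoped MatrixGroups

namespace FareyPSL

/-! ### Isometries of graphs: loxodromic actions and axes -/

section Dynamics

variable {V : Type*}

/-- The vertex permutation `φ` acts loxodromically on the graph `X` with base vertex `P`:
the limit of `d(P, φⁿ P) / n` exists and is positive. -/
def ActsLoxodromically (X : SimpleGraph V) (φ : Equiv.Perm V) (P : V) : Prop :=
  ∃ τ : ℝ, 0 < τ ∧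
    Tendsto (fun n : ℕ => (X.dist P ((φ ^ n) P) : ℝ) / (n : ℝ)) atTop (𝓝 τ)

/-- A bi-infinite geodesic of `X`, recorded by the sequence of its vertices. -/
def IsBiinfiniteGeodesic (X : SimpleGraph V) (γ : ℤ → V) : Prop :=
  ∀ m n : ℤ, X.dist (γ m) (γ n) = (m - n).natAbs

/-- `γ` is a geodesic axis of `φ`: a bi-infinite geodesic which connects the two limit points of
the orbit of `P` under the powers of `φ`, i.e. which is at finite Hausdorff distance from that
orbit. -/
def IsGeodesicAxis (X : SimpleGraph V) (φ : Equiv.Perm V) (P : V) (γ : ℤ → V) : Prop :=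
  IsBiinfiniteGeodesic X γ ∧
    ∃ C : ℕ, (∀ n : ℤ, ∃ m : ℤ, X.dist (γ m) ((φ ^ n) P) ≤ C) ∧
      ∀ m : ℤ, ∃ n : ℤ, X.dist (γ m) ((φ ^ n) P) ≤ C

/-- `φ` acts on the line `γ` as a translation. -/
def TranslatesLine (φ : Equiv.Perm V) (γ : ℤ → V) : Prop :=
  ∃ k : ℤ, ∀ n : ℤ, φ (γ n) = γ (n + k)

/-- The axis of `φ` passes within distance `r` of `P`: `φ` translates some geodesic axis, and
every geodesic axis of `φ` has a vertex at distance at most `r` from `P`. -/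
def AxisPassesWithin (X : SimpleGraph V) (φ : Equiv.Perm V) (P : V) (r : ℕ) : Prop :=
  (∃ γ : ℤ → V, IsGeodesicAxis X φ P γ ∧ TranslatesLine φ γ) ∧
    ∀ γ : ℤ → V, IsGeodesicAxis X φ P γ → ∃ n : ℤ, X.dist P (γ n) ≤ r

end Dynamics

/-! ### The Farey graph -/

/-- Numerator of a reduced fraction in `ℚ ∪ {∞}`, where `∞ = 1/0`. -/
def num (x : OnePoint ℚ) : ℤ := x.elim 1 (fun q => q.num)

/-- Denominator of a reduced fraction in `ℚ ∪ {∞}`, where `∞ = 1/0`. -/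
def den (x : OnePoint ℚ) : ℤ := x.elim 0 (fun q => (q.den : ℤ))

/-- The Farey graph: the vertices are `ℚ ∪ {∞}`, and reduced fractions `p/q` and `r/s` are joined
by an edge if and only if `|p s - q r| = 1`. -/
def fareyGraph : SimpleGraph (OnePoint ℚ) where
  Adj x y := |num x * den y - den x * num y| = 1
  symm := ⟨fun x y h => by
    rw [← h, ← abs_neg]
    congr 1
    ring⟩
  loopless := ⟨fun x h => by
    rw [show num x * den x - den x * num x = 0 by ring] at h
    simp at h⟩

/-- The vertex `0/1` of the Farey graph. -/
def zeroVertex : OnePoint ℚ := ((0 : ℚ) : OnePoint ℚ)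

/-! ### `PSL(2, ℤ)` and its action by Möbius transformations -/

/-- `SL(2, ℤ)` acting on `ℚ ∪ {∞}` by `x ↦ (a x + b) / (c x + d)`. -/
noncomputable def slAction : SL(2, ℤ) →* Equiv.Perm (OnePoint ℚ) :=
  (MulAction.toPermHom (GL (Fin 2) ℚ) (OnePoint ℚ)).comp (Matrix.SpecialLinearGroup.mapGL ℚ)

theorem slAction_eq_one_of_mem_center (g : SL(2, ℤ)) (hg : g ∈ Subgroup.center SL(2, ℤ)) :
    slAction g = 1 := by
  obtain ⟨r, hr, hg⟩ := Matrix.SpecialLinearGroup.mem_center_iff.mp hg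
  rw [Matrix.scalar_apply] at hg
  have h00 : g 0 0 = r := by rw [← hg]; simp
  have h01 : g 0 1 = 0 := by rw [← hg]; simp
  have h10 : g 1 0 = 0 := by rw [← hg]; simp
  have h11 : g 1 1 = r := by rw [← hg]; simp
  have hr0 : (r : ℚ) ≠ 0 := by
    rintro h
    have : r = 0 := by exact_mod_cast h
    simp [this] at hr
  ext x : 1
  change Matrix.SpecialLinearGroup.mapGL ℚ g • x = x
  cases x with
  | infty => simp [OnePoint.smul_infty_eq_ite, h10]
  | coe q => simp [OnePoint.smul_some_eq_ite, h00, h01, h10, h11, hr0]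

/-- The induced action of `PSL(2, ℤ)` on the vertices of the Farey graph. -/
noncomputable def pslAction : PSL(2, ℤ) →* Equiv.Perm (OnePoint ℚ) :=
  QuotientGroup.lift (Subgroup.center SL(2, ℤ)) slAction slAction_eq_one_of_mem_center

/-- The matrix `A` with rows `(1, 1)` and `(0, 1)`. -/
def matA : SL(2, ℤ) := ⟨!![1, 1; 0, 1], by simp [Matrix.det_fin_two]⟩

/-- The matrix `B` with rows `(1, 0)` and `(-1, 1)`. -/
def matB : SL(2, ℤ) := ⟨!![1, 0; -1, 1], by simp [Matrix.det_fin_two]⟩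

/-- The class of the matrix `A` in `PSL(2, ℤ)`. -/
def A : PSL(2, ℤ) := QuotientGroup.mk matA

/-- The class of the matrix `B` in `PSL(2, ℤ)`. -/
def B : PSL(2, ℤ) := QuotientGroup.mk matB

/-- The ball of radius `l` centred at `1` in the Cayley graph of `PSL(2, ℤ)` with respect to the
generators `A`, `A⁻¹`, `B`, `B⁻¹`. -/
def cayleyBall (l : ℕ) : Set PSL(2, ℤ) :=
  {g | (SimpleGraph.mulCayley ({A, A⁻¹, B, B⁻¹} : Set PSL(2, ℤ))).edist 1 g ≤ (l : ℕ∞)}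

/-- The elements of the ball of radius `l` that act loxodromically on the Farey graph and whose
axis passes within distance `1` of the vertex `0/1`. -/
def loxodromicInBall (l : ℕ) : Set PSL(2, ℤ) :=
  {g ∈ cayleyBall l | ActsLoxodromically fareyGraph (pslAction g) zeroVertex ∧
    AxisPassesWithin fareyGraph (pslAction g) zeroVertex 1}

end FareyPSL

namespace FareyPSL

/-! ### Reduced fractions -/

/-! A matrix `g` mapping `[0, ∞]` into `(0, 1/2]` (`IsContracting`) is loxodromic with axis near
`0`. Indeed `g⁻ⁿ.0` is nonpositive and `g.0` lies in `(0, 1/2]`. A path between such points that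
misses `0` must visit `∞` and `1/2`, which are non-adjacent neighbours of `0`, so going through `0`
is no longer (`dist_eq_add`). Hence `d(0, gⁿ.0) = n d(0, g.0)` (`dist_pow`): the orbit lies on a
geodesic, which gives the translation length and a translated axis. An axis avoiding the 1-ball
around `0` would stay on one side of the edge from `0` to `∞`, while the two ends of the orbit lie
on different sides (`axis_near`).

Such elements have positive density because every element of the group becomes contracting after
bounded corrections: up to factors `1` or `S` on both sides it is a nonnegative matrix `m`
(`exists_isNonneg`), and `B⁻² m A` is contracting. So boundedly many two-sided translates of the
good set in the ball of radius `l + 9` cover the ball of radius `l`, and enlarging the radius by 9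
multiplies the ball by a bounded factor. -/

theorem isCoprime_num_den (x : OnePoint ℚ) : IsCoprime (num x) (den x) := by
  cases x with
  | infty => exact isCoprime_one_left
  | coe q => exact Rat.isCoprime_num_den q

theorem eq_of_num_mul_den_eq {x y : OnePoint ℚ} (h : num x * den y = num y * den x) : x = y := by
  cases x with
  | infty =>
    cases y with
    | infty => rfl
    | coe q =>
      have : (1 : ℤ) * q.den = q.num * 0 := h
      simp at this
  | coe p =>
    cases y with
    | infty =>
      have h0 : p.num * 0 = (1 : ℤ) * p.den := h
      have := p.den_pos
      omega
    | coe q => exact congrArg _ (Rat.eq_iff_mul_eq_mul.mpr h)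

/-- The vertex `p / q`, with `p / 0 = ∞`. -/
noncomputable def ratio (p q : ℤ) : OnePoint ℚ :=
  if q = 0 then OnePoint.infty else ((p / q : ℚ) : OnePoint ℚ)

theorem num_den_ratio_of_pos {p q : ℤ} (h : IsCoprime p q) (hq : 0 < q) :
    num (ratio p q) = p ∧ den (ratio p q) = q := by
  have hc : Nat.Coprime p.natAbs q.natAbs := Int.isCoprime_iff_gcd_eq_one.mp h
  rw [ratio, if_neg hq.ne']
  exact ⟨Rat.num_div_eq_of_coprime hq hc, Rat.den_div_eq_of_coprime hq hc⟩

/-- Normalising the denominator may flip both signs. The sign `ε` is harmless, since all later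
conditions are quadratic in `(num, den)`. -/
theorem num_den_ratio {p q : ℤ} (h : IsCoprime p q) :
    ∃ ε : ℤ, ε * ε = 1 ∧ num (ratio p q) = ε * p ∧ den (ratio p q) = ε * q := by
  rcases lt_trichotomy q 0 with hq | hq | hq
  · have := num_den_ratio_of_pos h.neg_neg (neg_pos.mpr hq)
    refine ⟨-1, by norm_num, ?_⟩
    have hr : ratio (-p) (-q) = ratio p q := by simp [ratio, neg_div_neg_eq]
    rw [hr] at this
    simpa using this
  · subst hq
    refine ⟨p, ?_, ?_, ?_⟩
    · rcases Int.isUnit_iff.mp (isCoprime_zero_right.mp h) with h | h <;> simp [h]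
    · have : num (ratio p 0) = 1 := by simp [ratio, num]
      rw [this]
      rcases Int.isUnit_iff.mp (isCoprime_zero_right.mp h) with h | h <;> simp [h]
    · simp [ratio, den]
  · exact ⟨1, by norm_num, by simpa using num_den_ratio_of_pos h hq⟩

theorem slAction_apply_eq_ratio (g : SL(2, ℤ)) (x : OnePoint ℚ) :
    slAction g x =
      ratio (g 0 0 * num x + g 0 1 * den x) (g 1 0 * num x + g 1 1 * den x) := by
  change Matrix.SpecialLinearGroup.mapGL ℚ g • x = _
  cases x with
  | infty =>
    simp [OnePoint.smul_infty_eq_ite, ratio, num, den]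
  | coe q =>
    have hq : (q.den : ℚ) ≠ 0 := by simp
    have hn : (q.num : ℚ) = q * q.den := (Rat.mul_den_eq_num q).symm
    have h1 : ((g 1 0 * q.num + g 1 1 * q.den : ℤ) : ℚ) = (g 1 0 * q + g 1 1) * q.den := by
      push_cast
      rw [hn]
      ring
    have h0 : ((g 0 0 * q.num + g 0 1 * q.den : ℤ) : ℚ) = (g 0 0 * q + g 0 1) * q.den := by
      push_cast
      rw [hn]
      ring
    have h2 : g 1 0 * q.num + g 1 1 * q.den = 0 ↔ (g 1 0 * q + g 1 1 : ℚ) = 0 := by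
      rw [← @Int.cast_eq_zero ℚ, h1]
      simp
    simp only [OnePoint.smul_some_eq_ite, ratio, num, den, OnePoint.elim_some, h2, h1, h0]
    simp [mul_div_mul_right _ _ hq]

theorem det_eq_one (g : SL(2, ℤ)) : g 0 0 * g 1 1 - g 0 1 * g 1 0 = 1 := by
  rw [← Matrix.det_fin_two, g.det_coe]

theorem num_den_slAction (g : SL(2, ℤ)) (x : OnePoint ℚ) :
    ∃ ε : ℤ, ε * ε = 1 ∧ num (slAction g x) = ε * (g 0 0 * num x + g 0 1 * den x) ∧
      den (slAction g x) = ε * (g 1 0 * num x + g 1 1 * den x) := by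
  rw [slAction_apply_eq_ratio]
  apply num_den_ratio
  obtain ⟨u, v, h⟩ := isCoprime_num_den x
  have hg := det_eq_one g
  refine ⟨u * g 1 1 - v * g 1 0, v * g 0 0 - u * g 0 1, ?_⟩
  linear_combination h * (g 0 0 * g 1 1 - g 0 1 * g 1 0) + hg

theorem fareyGraph_adj {x y : OnePoint ℚ} :
    fareyGraph.Adj x y ↔ (num x * den y - den x * num y) * (num x * den y - den x * num y) = 1 := by
  change |_| = 1 ↔ _
  rw [← abs_mul_abs_self]
  constructor
  · intro h
    rw [h]
    norm_num
  · intro h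
    nlinarith [abs_nonneg (num x * den y - den x * num y)]

/-! ### The Farey graph is connected and `PSL(2, ℤ)` acts on it by isometries -/

theorem slAction_adj (g : SL(2, ℤ)) {x y : OnePoint ℚ} (h : fareyGraph.Adj x y) :
    fareyGraph.Adj (slAction g x) (slAction g y) := by
  rw [fareyGraph_adj] at h ⊢
  obtain ⟨ε, hε, h1, h2⟩ := num_den_slAction g x
  obtain ⟨δ, hδ, h3, h4⟩ := num_den_slAction g y
  have hg := det_eq_one g
  have key : num (slAction g x) * den (slAction g y) - den (slAction g x) * num (slAction g y) =
      ε * δ * (num x * den y - den x * num y) := by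
    rw [h1, h2, h3, h4]
    linear_combination ε * δ * (num x * den y - den x * num y) * hg
  rw [key]
  calc _ = (ε * ε) * (δ * δ) *
      ((num x * den y - den x * num y) * (num x * den y - den x * num y)) := by ring
    _ = 1 := by rw [hε, hδ, h]; norm_num

/-- Euclidean descent: reducing a Bézout coefficient modulo the denominator gives a Farey neighbour
of smaller denominator. -/
theorem reachable_infty (n : ℕ) : ∀ x : OnePoint ℚ, (den x).natAbs = n →
    fareyGraph.Reachable x OnePoint.infty := by
  induction n using Nat.strong_induction_on with
  | _ n ih =>
    intro x hx
    have hd : 0 ≤ den x := by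
      cases x with
      | infty => exact le_rfl
      | coe q => exact Int.natCast_nonneg _
    have hc := isCoprime_num_den x
    rcases hd.eq_or_lt with h0 | hpos
    · suffices x = OnePoint.infty by rw [this]
      apply eq_of_num_mul_den_eq
      rw [← h0]
      simp [den]
    · obtain ⟨u, v, huv⟩ := hc
      -- `r / s` with `num x * s - den x * r = 1` and `0 ≤ s < den x`
      obtain ⟨r, s, hs0, hs, hrs⟩ : ∃ r s : ℤ, 0 ≤ s ∧ s < den x ∧
          num x * s - den x * r = 1 := by
        refine ⟨-v - num x * (u / den x), u % den x, Int.emod_nonneg _ hpos.ne',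
          Int.emod_lt_of_pos _ hpos, ?_⟩
        have := Int.emod_add_mul_ediv u (den x)
        linear_combination huv + num x * this
      have hcop : IsCoprime r s := ⟨-den x, num x, by linear_combination hrs⟩
      obtain ⟨ε, hε, hn, hdn⟩ := num_den_ratio hcop
      have hadj : fareyGraph.Adj x (ratio r s) := by
        rw [fareyGraph_adj, hn, hdn]
        linear_combination
          (num x * s - den x * r) * (num x * s - den x * r) * hε + (num x * s - den x * r + 1) * hrs
      refine hadj.reachable.trans (ih _ ?_ _ rfl)
      rw [hdn, Int.natAbs_mul, Int.isUnit_iff_natAbs_eq.mp (IsUnit.of_mul_eq_one _ hε)]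
      omega

theorem fareyGraph_connected : fareyGraph.Connected :=
  have : Nonempty (OnePoint ℚ) := ⟨OnePoint.infty⟩
  ⟨fun x y => (reachable_infty _ x rfl).trans (reachable_infty _ y rfl).symm⟩

theorem dist_slAction_le (g : SL(2, ℤ)) (x y : OnePoint ℚ) :
    fareyGraph.dist (slAction g x) (slAction g y) ≤ fareyGraph.dist x y := by
  obtain ⟨w, hw⟩ := fareyGraph_connected.exists_walk_length_eq_dist x y
  let f : fareyGraph →g fareyGraph := ⟨slAction g, fun h => slAction_adj g h⟩
  rw [← hw, ← w.length_map f]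
  exact SimpleGraph.dist_le _

theorem dist_slAction (g : SL(2, ℤ)) (x y : OnePoint ℚ) :
    fareyGraph.dist (slAction g x) (slAction g y) = fareyGraph.dist x y := by
  refine (dist_slAction_le g x y).antisymm ?_
  simpa [← Equiv.Perm.mul_apply, ← map_mul] using
    dist_slAction_le g⁻¹ (slAction g x) (slAction g y)

/-! ### Separating edges -/

theorem num_ne_zero {x : OnePoint ℚ} (h : x ≠ zeroVertex) : num x ≠ 0 := by
  intro h0
  apply h
  apply eq_of_num_mul_den_eq
  rw [h0]
  simp [zeroVertex, num]

/-- A walk avoiding `0` cannot jump across a vertex `1 / k`. -/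
theorem exists_mem_support (k : ℤ) {x y : OnePoint ℚ} (w : fareyGraph.Walk x y)
    (hw : zeroVertex ∉ w.support) (hx : den x * num x ≤ k * (num x * num x))
    (hy : k * (num y * num y) ≤ den y * num y) : ∃ z ∈ w.support, den z = k * num z := by
  -- Away from `0` the numerator is nonzero, so the hypotheses say `1/x ≤ k ≤ 1/y`, with `1/∞ = 0`.
  induction w with
  | nil =>
    rename_i x
    have h0 : num x ≠ 0 := num_ne_zero fun h => hw (by simp [h])
    refine ⟨x, by simp, mul_right_cancel₀ h0 ?_⟩
    linarith
  | @cons x x' y h w ih =>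
    rw [SimpleGraph.Walk.support_cons, List.mem_cons, not_or] at hw
    have h0 : num x ≠ 0 := num_ne_zero (Ne.symm hw.1)
    have h0' : num x' ≠ 0 := num_ne_zero fun h => hw.2 (by simp [← h])
    by_cases hx' : den x' * num x' ≤ k * (num x' * num x')
    · obtain ⟨z, hz, hzk⟩ := ih hw.2 hx' hy
      exact ⟨z, by simp [hz], hzk⟩
    by_cases hxk : den x = k * num x
    · exact ⟨x, by simp, hxk⟩
    exfalso
    rw [fareyGraph_adj] at h
    -- with `a = k num x - den x`, `b = den x' - k num x'`, the determinant is `num x b + a num x'`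
    have ha : 1 ≤ (k * num x - den x) * num x := by
      have : (k * num x - den x) * num x ≠ 0 :=
        mul_ne_zero (fun h => hxk (by linarith)) h0
      have : 0 ≤ (k * num x - den x) * num x := by linarith
      omega
    have hb : 1 ≤ (den x' - k * num x') * num x' := by linarith
    have hdet : num x * den x' - den x * num x' =
        num x * (den x' - k * num x') + (k * num x - den x) * num x' := by ring
    rw [hdet] at h
    -- The squared determinant is at least four times this product, so it cannot be 1.
    have h1 : 1 ≤ ((k * num x - den x) * num x) * ((den x' - k * num x') * num x') := by
      nlinarith
    nlinarith [sq_nonneg (num x * (den x' - k * num x') - (k * num x - den x) * num x')]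

/-- Coprimality forces the numerator to be a unit, so `z = 1/k`. -/
theorem adj_zeroVertex {z : OnePoint ℚ} (k : ℤ) (h : den z = k * num z) :
    fareyGraph.Adj z zeroVertex := by
  obtain ⟨u, v, huv⟩ := isCoprime_num_den z
  have hu : IsUnit (num z) := IsUnit.of_mul_eq_one (u + v * k) (by
    rw [h] at huv; linear_combination huv)
  rw [fareyGraph_adj]
  have h1 : num zeroVertex = 0 := rfl
  have h2 : den zeroVertex = 1 := rfl
  rw [h1, h2]
  rcases Int.isUnit_iff.mp hu with h | h <;> simp [h]

theorem exists_dist_le_one {x y : OnePoint ℚ} (w : fareyGraph.Walk x y)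
    (hx : den x * num x ≤ 0) (hy : 0 ≤ den y * num y) :
    ∃ z ∈ w.support, fareyGraph.dist zeroVertex z ≤ 1 := by
  by_cases hw : zeroVertex ∈ w.support
  · exact ⟨_, hw, by simp⟩
  · obtain ⟨z, hz, hk⟩ := exists_mem_support 0 w hw (by simpa using hx) (by simpa using hy)
    exact ⟨z, hz, (SimpleGraph.dist_eq_one_iff_adj.mpr (adj_zeroVertex 0 hk).symm).le⟩

/-- A path from `x` to `y` missing `0` visits `z = ∞` and then `z' = 1/2`. These are at distance at
least 2, so the stretch between them can be replaced by `z, 0, z'` at no cost. -/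
theorem dist_eq_add {x y : OnePoint ℚ} (hx : den x * num x ≤ 0)
    (hy : 2 * (num y * num y) ≤ den y * num y) :
    fareyGraph.dist x y = fareyGraph.dist x zeroVertex + fareyGraph.dist zeroVertex y := by
  classical
  have hconn := fareyGraph_connected
  refine hconn.dist_triangle.antisymm ?_
  obtain ⟨w, hw⟩ := hconn.exists_walk_length_eq_dist x y
  rw [← hw]
  by_cases h0 : zeroVertex ∈ w.support
  · rw [← w.take_spec h0, SimpleGraph.Walk.length_append]
    exact add_le_add (SimpleGraph.dist_le _) (SimpleGraph.dist_le _)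
  · have hy0 : 0 ≤ den y * num y := by nlinarith [mul_self_nonneg (num y)]
    obtain ⟨z, hz, hzk⟩ := exists_mem_support 0 w h0 (by simpa using hx) (by simpa using hy0)
    have hdrop : zeroVertex ∉ (w.dropUntil z hz).support := fun h =>
      h0 (w.support_dropUntil_subset_support hz h)
    obtain ⟨z', hz', hzk'⟩ := exists_mem_support 2 (w.dropUntil z hz) hdrop (by
      rw [hzk]; nlinarith [mul_self_nonneg (num z)]) hy
    have hz0 : num z ≠ 0 := num_ne_zero fun h => h0 (by rwa [← h])
    have hz0' : num z' ≠ 0 := num_ne_zero fun h => hdrop (by rwa [← h])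
    have hne : z ≠ z' := by
      rintro rfl
      apply hz0
      omega
    -- The determinant is even.
    have hnadj : ¬ fareyGraph.Adj z z' := by
      rw [fareyGraph_adj, hzk, hzk']
      intro h
      have : (2 * (num z * num z')) * (2 * (num z * num z')) = 1 := by linear_combination h
      have := Int.isUnit_iff.mp (IsUnit.of_mul_eq_one _ this)
      omega
    have h2 := hconn.one_lt_dist_of_ne_of_not_adj hne hnadj
    have hxz : fareyGraph.dist z zeroVertex = 1 :=
      SimpleGraph.dist_eq_one_iff_adj.mpr (adj_zeroVertex 0 hzk)
    have hzy : fareyGraph.dist zeroVertex z' = 1 :=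
      SimpleGraph.dist_eq_one_iff_adj.mpr (adj_zeroVertex 2 hzk').symm
    have t1 := hconn.dist_triangle (u := x) (v := z) (w := zeroVertex)
    have t2 := hconn.dist_triangle (u := zeroVertex) (v := z') (w := y)
    have l1 := SimpleGraph.dist_le (w.takeUntil z hz)
    have l2 := SimpleGraph.dist_le ((w.dropUntil z hz).takeUntil z' hz')
    have l3 := SimpleGraph.dist_le ((w.dropUntil z hz).dropUntil z' hz')
    have e1 := congrArg SimpleGraph.Walk.length (w.take_spec hz)
    have e2 := congrArg SimpleGraph.Walk.length ((w.dropUntil z hz).take_spec hz')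
    rw [SimpleGraph.Walk.length_append] at e1 e2
    omega

/-! ### Isometries whose orbit is aligned along geodesics -/

section Dynamics

variable {V : Type*} {X : SimpleGraph V} {φ : Equiv.Perm V} {P : V}

theorem dist_zpow (hφ : ∀ x y, X.dist (φ x) (φ y) = X.dist x y) (k : ℤ) (x y : V) :
    X.dist ((φ ^ k) x) ((φ ^ k) y) = X.dist x y := by
  induction k generalizing x y with
  | zero => simp
  | succ k ih =>
    rw [zpow_add_one, Equiv.Perm.mul_apply, Equiv.Perm.mul_apply, ih, hφ]
  | pred k ih =>
    rw [zpow_sub_one, Equiv.Perm.mul_apply, Equiv.Perm.mul_apply, ih, ← hφ]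
    simp

theorem dist_zpow_zpow (hφ : ∀ x y, X.dist (φ x) (φ y) = X.dist x y)
    (hP : ∀ n : ℕ, X.dist P ((φ ^ n) P) = n * X.dist P (φ P)) (a b : ℤ) :
    X.dist ((φ ^ a) P) ((φ ^ b) P) = (a - b).natAbs * X.dist P (φ P) := by
  wlog h : a ≤ b generalizing a b
  · rw [SimpleGraph.dist_comm, this b a (by omega), ← Int.natAbs_neg, neg_sub]
  obtain ⟨n, rfl⟩ := Int.le.dest h
  rw [zpow_add, Equiv.Perm.mul_apply, dist_zpow hφ, zpow_natCast, hP]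
  congr 1
  omega

theorem actsLoxodromically_of_dist_pow (h0 : 0 < X.dist P (φ P))
    (hP : ∀ n : ℕ, X.dist P ((φ ^ n) P) = n * X.dist P (φ P)) :
    ActsLoxodromically X φ P := by
  refine ⟨X.dist P (φ P), by exact_mod_cast h0, tendsto_const_nhds.congr' ?_⟩
  filter_upwards [eventually_gt_atTop 0] with n hn
  have : (n : ℝ) ≠ 0 := by positivity
  rw [hP]
  push_cast
  field_simp

theorem dist_le_natAbs_of_dist_succ_le_one (hX : X.Connected) {γ : ℤ → V}
    (h : ∀ m, X.dist (γ m) (γ (m + 1)) ≤ 1) (m n : ℤ) :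
    X.dist (γ m) (γ n) ≤ (m - n).natAbs := by
  wlog hmn : m ≤ n generalizing m n
  · rw [SimpleGraph.dist_comm, ← Int.natAbs_neg, neg_sub]
    exact this n m (by omega)
  obtain ⟨k, rfl⟩ := Int.le.dest hmn
  clear hmn
  induction k with
  | zero => simp
  | succ k ih =>
    have t := hX.dist_triangle (u := γ m) (v := γ (m + k)) (w := γ (m + k + 1))
    have := h (m + k)
    push_cast
    rw [← add_assoc]
    omega

/-- The axis concatenates the `φ`-translates of one geodesic from `P` to `φ P`. -/
theorem exists_axis_of_dist_pow (hX : X.Connected) (hφ : ∀ x y, X.dist (φ x) (φ y) = X.dist x y)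
    (h0 : 0 < X.dist P (φ P)) (hP : ∀ n : ℕ, X.dist P ((φ ^ n) P) = n * X.dist P (φ P)) :
    ∃ γ : ℤ → V, IsGeodesicAxis X φ P γ ∧ TranslatesLine φ γ := by
  obtain ⟨w, hw⟩ := hX.exists_walk_length_eq_dist P (φ P)
  set D := X.dist P (φ P) with hD
  have hDpos : (0 : ℤ) < D := by exact_mod_cast h0
  let γ : ℤ → V := fun m => (φ ^ (m / D)) (w.getVert (m % D).toNat)
  have hγ0 (q : ℤ) : γ (q * D) = (φ ^ q) P := by
    simp only [γ, Int.mul_ediv_cancel _ hDpos.ne', Int.mul_emod_left]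
    simp
  have hγ (q : ℤ) (r : ℕ) (hr : r ≤ D) : γ (q * D + r) = (φ ^ q) (w.getVert r) := by
    rcases hr.lt_or_eq with hr | rfl
    · have h1 : (q * D + r) / (D : ℤ) = q := by
        rw [add_comm, Int.add_mul_ediv_right _ _ hDpos.ne', Int.ediv_eq_zero_of_lt] <;> omega
      have h2 : (q * D + r) % (D : ℤ) = r := by
        rw [add_comm, Int.add_mul_emod_self_right, Int.emod_eq_of_lt] <;> omega
      simp [γ, h1, h2]
    · have : q * (D : ℤ) + D = (q + 1) * D := by ring
      rw [this, hγ0, ← hw, SimpleGraph.Walk.getVert_length, zpow_add_one, Equiv.Perm.mul_apply]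
  have hsucc (m : ℤ) : X.dist (γ m) (γ (m + 1)) ≤ 1 := by
    have hm := Int.emod_add_mul_ediv m D
    have hm0 := Int.emod_nonneg m hDpos.ne'
    have hm1 := Int.emod_lt_of_pos m hDpos
    obtain ⟨r, hr⟩ := Int.eq_ofNat_of_zero_le hm0
    have e1 : m = m / D * D + r := by linarith
    have e2 : m + 1 = m / D * D + (r + 1 : ℕ) := by push_cast; linarith
    rw [e2]
    nth_rw 1 [e1]
    rw [hγ _ r (by omega), hγ _ (r + 1) (by omega), dist_zpow hφ]
    exact (SimpleGraph.dist_eq_one_iff_adj.mpr (w.adj_getVert_succ (by omega))).le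
  have hle := dist_le_natAbs_of_dist_succ_le_one hX hsucc
  refine ⟨γ, ⟨fun m n => ?_, D, fun n => ⟨n * D, by simp [hγ0]⟩, fun m => ⟨m / D, ?_⟩⟩, D,
    fun n => ?_⟩
  · wlog hmn : m ≤ n generalizing m n
    · rw [SimpleGraph.dist_comm, this n m (by omega), ← Int.natAbs_neg, neg_sub]
    refine (hle m n).antisymm ?_
    -- Enclose `m` and `n` between orbit points. The path between these has length equal to their
    -- distance, so its subpath from `m` to `n` is geodesic too.
    have key := dist_zpow_zpow hφ hP (m / D) (n / D + 1)
    rw [← hγ0, ← hγ0, ← hD] at key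
    have hm := Int.emod_add_mul_ediv m D
    have hm0 := Int.emod_nonneg m hDpos.ne'
    have hn := Int.emod_add_mul_ediv n D
    have hn1 := Int.emod_lt_of_pos n hDpos
    have hq : m / D ≤ n / D := Int.ediv_le_ediv hDpos hmn
    have t1 := hX.dist_triangle (u := γ (m / D * D)) (v := γ m) (w := γ ((n / D + 1) * D))
    have t2 := hX.dist_triangle (u := γ m) (v := γ n) (w := γ ((n / D + 1) * D))
    have l1 := hle (m / D * D) m
    have l2 := hle n ((n / D + 1) * D)
    have key' : (X.dist (γ (m / D * D)) (γ ((n / D + 1) * D)) : ℤ) =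
        (n / D + 1) * D - m / D * D := by
      rw [key]
      push_cast
      rw [abs_of_neg (by omega)]
      ring
    have hm' : m / D * D = m - m % D := by linarith
    have hn' : (n / D + 1) * D = n + (D - n % D) := by linarith
    rw [hm'] at key' t1 l1
    rw [hn'] at key' t1 t2 l2
    omega
  · rw [← hγ0]
    refine (hle _ _).trans ?_
    have hm := Int.emod_add_mul_ediv m D
    have hm0 := Int.emod_nonneg m hDpos.ne'
    have hm1 := Int.emod_lt_of_pos m hDpos
    have : m - m / D * D = m % D := by linarith
    omega
  · have h1 : (n + D) / (D : ℤ) = n / D + 1 := by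
      rw [Int.add_ediv_of_dvd_right (dvd_refl _), Int.ediv_self hDpos.ne']
    simp only [γ, h1, Int.add_emod_right]
    rw [add_comm, zpow_add, zpow_one, Equiv.Perm.mul_apply]

end Dynamics

/-! ### Matrices with positive entries -/

/-- Matrices mapping the interval `[0, ∞]` into `(0, 1/2]`. -/
structure IsContracting (g : SL(2, ℤ)) : Prop where
  pos00 : 0 < g 0 0
  pos01 : 0 < g 0 1
  le0 : 2 * g 0 0 ≤ g 1 0
  le1 : 2 * g 0 1 ≤ g 1 1

theorem num_zeroVertex : num zeroVertex = 0 := rfl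

theorem den_zeroVertex : den zeroVertex = 1 := rfl

namespace IsContracting

variable {g : SL(2, ℤ)}

theorem slAction_nonneg (hg : IsContracting g) {x : OnePoint ℚ} (hx : 0 ≤ den x * num x) :
    0 ≤ den (slAction g x) * num (slAction g x) ∧
    2 * (num (slAction g x) * num (slAction g x)) ≤ den (slAction g x) * num (slAction g x) := by
  obtain ⟨ε, hε, h1, h2⟩ := num_den_slAction g x
  obtain ⟨ha, hb, hc, hd⟩ := hg
  rw [h1, h2]
  generalize num x = p at *
  generalize den x = q at *
  have e1 : ε * (g 1 0 * p + g 1 1 * q) * (ε * (g 0 0 * p + g 0 1 * q)) =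
      (g 1 0 * p + g 1 1 * q) * (g 0 0 * p + g 0 1 * q) := by
    linear_combination (g 1 0 * p + g 1 1 * q) * (g 0 0 * p + g 0 1 * q) * hε
  have e2 : ε * (g 0 0 * p + g 0 1 * q) * (ε * (g 0 0 * p + g 0 1 * q)) =
      (g 0 0 * p + g 0 1 * q) * (g 0 0 * p + g 0 1 * q) := by
    linear_combination (g 0 0 * p + g 0 1 * q) * (g 0 0 * p + g 0 1 * q) * hε
  rw [e1, e2]
  -- As a form in `p² , q², pq` this has nonnegative coefficients, and `pq ≥ 0`.
  have key : 0 ≤ ((g 1 0 - 2 * g 0 0) * p + (g 1 1 - 2 * g 0 1) * q) *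
      (g 0 0 * p + g 0 1 * q) := by
    have : ((g 1 0 - 2 * g 0 0) * p + (g 1 1 - 2 * g 0 1) * q) * (g 0 0 * p + g 0 1 * q) =
      (g 1 0 - 2 * g 0 0) * g 0 0 * (p * p) + (g 1 1 - 2 * g 0 1) * g 0 1 * (q * q) +
      ((g 1 0 - 2 * g 0 0) * g 0 1 + (g 1 1 - 2 * g 0 1) * g 0 0) * (q * p) := by ring
    rw [this]
    have := sub_nonneg.mpr hc
    have := sub_nonneg.mpr hd
    have := mul_self_nonneg p
    have := mul_self_nonneg q
    positivity
  constructor <;> nlinarith [mul_self_nonneg (g 0 0 * p + g 0 1 * q)]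

/-- Since `g` maps `[0, ∞]` into `(0, ∞)`, its inverse preserves the complementary interval. -/
theorem slAction_inv_nonpos (hg : IsContracting g) {x : OnePoint ℚ} (hx : den x * num x ≤ 0) :
    den (slAction g⁻¹ x) * num (slAction g⁻¹ x) ≤ 0 := by
  obtain ⟨ε, hε, h1, h2⟩ := num_den_slAction g⁻¹ x
  obtain ⟨ha, hb, hc, hd⟩ := hg
  have i00 : g⁻¹ 0 0 = g 1 1 := by simp [Matrix.SpecialLinearGroup.SL2_inv_expl]
  have i01 : g⁻¹ 0 1 = -g 0 1 := by simp [Matrix.SpecialLinearGroup.SL2_inv_expl]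
  have i10 : g⁻¹ 1 0 = -g 1 0 := by simp [Matrix.SpecialLinearGroup.SL2_inv_expl]
  have i11 : g⁻¹ 1 1 = g 0 0 := by simp [Matrix.SpecialLinearGroup.SL2_inv_expl]
  rw [i00, i01] at h1
  rw [i10, i11] at h2
  rw [h1, h2]
  generalize num x = p at *
  generalize den x = q at *
  have e1 : ε * (-g 1 0 * p + g 0 0 * q) * (ε * (g 1 1 * p + -g 0 1 * q)) =
      -(g 1 0 * g 1 1 * (p * p) + g 0 0 * g 0 1 * (q * q) +
        (g 0 0 * g 1 1 + g 0 1 * g 1 0) * -(q * p)) := by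
    linear_combination (-g 1 0 * p + g 0 0 * q) * (g 1 1 * p + -g 0 1 * q) * hε
  rw [e1, neg_nonpos]
  have : 0 ≤ -(q * p) := by linarith
  have : 0 < g 1 0 := by linarith
  have : 0 < g 1 1 := by linarith
  have := mul_self_nonneg p
  have := mul_self_nonneg q
  positivity

theorem pow_nonneg (hg : IsContracting g) (n : ℕ) :
    0 ≤ den ((slAction g ^ n) zeroVertex) * num ((slAction g ^ n) zeroVertex) := by
  induction n with
  | zero => simp [num_zeroVertex]
  | succ n ih =>
    rw [pow_succ', Equiv.Perm.mul_apply]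
    exact (hg.slAction_nonneg ih).1

theorem inv_pow_nonpos (hg : IsContracting g) (n : ℕ) :
    den (((slAction g)⁻¹ ^ n) zeroVertex) * num (((slAction g)⁻¹ ^ n) zeroVertex) ≤ 0 := by
  induction n with
  | zero => simp [num_zeroVertex]
  | succ n ih =>
    rw [pow_succ', Equiv.Perm.mul_apply, ← map_inv] at *
    exact hg.slAction_inv_nonpos ih

theorem dist_pos (hg : IsContracting g) :
    0 < fareyGraph.dist zeroVertex (slAction g zeroVertex) := by
  refine fareyGraph_connected.pos_dist_of_ne fun h => ?_
  obtain ⟨ε, hε, h1, -⟩ := num_den_slAction g zeroVertex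
  rw [← h, num_zeroVertex, den_zeroVertex] at h1
  have := hg.pos01
  have hε0 : ε ≠ 0 := by rintro rfl; simp at hε
  have : ε * g 0 1 ≠ 0 := mul_ne_zero hε0 (by omega)
  apply this
  linarith

/-- Translating by `gⁿ` turns `dist_eq_add`, applied to `g⁻ⁿ.0` and `g.0`, into additivity along the
orbit. -/
theorem dist_pow (hg : IsContracting g) (n : ℕ) :
    fareyGraph.dist zeroVertex ((slAction g ^ n) zeroVertex) =
      n * fareyGraph.dist zeroVertex (slAction g zeroVertex) := by
  induction n with
  | zero => simp
  | succ n ih =>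
    have hinv : fareyGraph.dist (((slAction g)⁻¹ ^ n) zeroVertex) zeroVertex =
        fareyGraph.dist zeroVertex ((slAction g ^ n) zeroVertex) := by
      rw [← dist_slAction (g ^ n), ← Equiv.Perm.mul_apply, map_pow]
      simp
    have h := dist_eq_add (hg.inv_pow_nonpos n)
      (hg.slAction_nonneg (x := zeroVertex) (by simp [num_zeroVertex])).2
    rw [hinv, ih, ← dist_slAction (g ^ n), ← Equiv.Perm.mul_apply, map_pow] at h
    rw [pow_succ, Equiv.Perm.mul_apply, add_one_mul, ← h]
    simp

theorem axis_near (hg : IsContracting g) {γ : ℤ → OnePoint ℚ}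
    (hγ : IsGeodesicAxis fareyGraph (slAction g) zeroVertex γ) :
    ∃ n, fareyGraph.dist zeroVertex (γ n) ≤ 1 := by
  by_contra! hfar
  obtain ⟨hgeo, C, hC, -⟩ := hγ
  have hconn := fareyGraph_connected
  have hadj (m : ℤ) : fareyGraph.Adj (γ m) (γ (m + 1)) :=
    SimpleGraph.dist_eq_one_iff_adj.mp (by rw [hgeo]; simp)
  -- the axis stays on one side of the edge joining `0` to `∞`
  have hside {x y : OnePoint ℚ} (h : fareyGraph.Adj x y)
      (hx : 1 < fareyGraph.dist zeroVertex x) (hy : 1 < fareyGraph.dist zeroVertex y) :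
      0 < den x * num x ↔ 0 < den y * num y := by
    have aux {x y : OnePoint ℚ} (h : fareyGraph.Adj x y)
        (hx : 1 < fareyGraph.dist zeroVertex x) (hy : 1 < fareyGraph.dist zeroVertex y)
        (h0 : 0 < den x * num x) : 0 < den y * num y := by
      by_contra! hn
      obtain ⟨z, hz, hz1⟩ := exists_dist_le_one h.symm.toWalk hn h0.le
      simp only [SimpleGraph.Walk.support_cons, SimpleGraph.Walk.support_nil,
        List.mem_cons, List.not_mem_nil, or_false] at hz
      rcases hz with rfl | rfl <;> omega
    exact ⟨aux h hx hy, aux h.symm hy hx⟩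
  have hall (m : ℤ) : 0 < den (γ m) * num (γ m) ↔ 0 < den (γ 0) * num (γ 0) := by
    induction m with
    | zero => rfl
    | succ k ih => rw [← ih]; exact (hside (hadj k) (hfar _) (hfar _)).symm
    | pred k ih =>
      rw [← ih]
      have := hadj (-k - 1)
      rw [sub_add_cancel] at this
      exact hside this (hfar _) (hfar _)
  -- a short path across the edge bounds the displacement
  have hcross {x y : OnePoint ℚ} (h : fareyGraph.dist x y ≤ C) (hx : den x * num x ≤ 0)
      (hy : 0 ≤ den y * num y) : fareyGraph.dist zeroVertex x ≤ C + 1 ∧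
        fareyGraph.dist zeroVertex y ≤ C + 1 := by
    classical
    obtain ⟨w, hw⟩ := hconn.exists_walk_length_eq_dist x y
    obtain ⟨z, hz, hz1⟩ := exists_dist_le_one w hx hy
    have e := congrArg SimpleGraph.Walk.length (w.take_spec hz)
    rw [SimpleGraph.Walk.length_append] at e
    have l1 := SimpleGraph.dist_le (w.takeUntil z hz)
    have l2 := SimpleGraph.dist_le (w.dropUntil z hz)
    have t1 := hconn.dist_triangle (u := zeroVertex) (v := z) (w := x)
    have t2 := hconn.dist_triangle (u := zeroVertex) (v := z) (w := y)
    rw [fareyGraph.dist_comm (u := z) (v := x)] at t1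
    omega
  have hD := hg.dist_pos
  -- The exponent `C + 2` just beats the bound `C + 1` of `hcross`.
  have hbig (k : ℤ) (hk : k.natAbs = C + 2) :
      C + 1 < fareyGraph.dist zeroVertex ((slAction g ^ k) zeroVertex) := by
    have := dist_zpow_zpow (dist_slAction g) hg.dist_pow 0 k
    rw [zpow_zero, Equiv.Perm.one_apply, zero_sub, Int.natAbs_neg, hk] at this
    rw [this]
    nlinarith
  -- Compare the axis with the half of the orbit on the other side: backward if the axis is
  -- positive, forward otherwise.
  by_cases hpos : 0 < den (γ 0) * num (γ 0)
  · obtain ⟨m, hm⟩ := hC (-(C + 2 : ℕ))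
    have h1 := hbig (-(C + 2 : ℕ)) (by omega)
    rw [zpow_neg, zpow_natCast, ← inv_pow] at hm h1
    rw [SimpleGraph.dist_comm] at hm
    have := hcross hm (hg.inv_pow_nonpos _) ((hall m).mpr hpos).le
    omega
  · obtain ⟨m, hm⟩ := hC (C + 2 : ℕ)
    have h1 := hbig (C + 2 : ℕ) (by omega)
    rw [zpow_natCast] at hm h1
    have := hcross hm (not_lt.mp ((hall m).not.mpr hpos)) (hg.pow_nonneg _)
    omega

theorem actsLoxodromically (hg : IsContracting g) :
    ActsLoxodromically fareyGraph (slAction g) zeroVertex :=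
  actsLoxodromically_of_dist_pow hg.dist_pos hg.dist_pow

theorem axisPassesWithin (hg : IsContracting g) :
    AxisPassesWithin fareyGraph (slAction g) zeroVertex 1 :=
  ⟨exists_axis_of_dist_pow fareyGraph_connected (dist_slAction g) hg.dist_pos hg.dist_pow,
    fun _ hγ => hg.axis_near hγ⟩

end IsContracting

/-! ### Every element is contracting up to bounded corrections -/

theorem mk_neg (m : SL(2, ℤ)) :
    (QuotientGroup.mk (-m) : PSL(2, ℤ)) = QuotientGroup.mk m := by
  rw [QuotientGroup.eq, Matrix.SpecialLinearGroup.mem_center_iff]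
  refine ⟨-1, by norm_num, ?_⟩
  have : (-m)⁻¹ * m = -1 := by
    rw [inv_mul_eq_iff_eq_mul]
    simp
  rw [this]
  ext i j
  fin_cases i <;> fin_cases j <;> simp

/-- The rotation `x ↦ -1 / x`. -/
def matS : SL(2, ℤ) := ⟨!![0, 1; -1, 0], by simp [Matrix.det_fin_two]⟩

theorem mul_entry (g h : SL(2, ℤ)) (i j : Fin 2) :
    (g * h) i j = g i 0 * h 0 j + g i 1 * h 1 j := by
  rw [Matrix.SpecialLinearGroup.coe_mul, Matrix.mul_apply, Fin.sum_univ_two]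

theorem matS_entries : matS 0 0 = 0 ∧ matS 0 1 = 1 ∧ matS 1 0 = -1 ∧ matS 1 1 = 0 :=
  ⟨rfl, rfl, rfl, rfl⟩

theorem matA_entries : matA 0 0 = 1 ∧ matA 0 1 = 1 ∧ matA 1 0 = 0 ∧ matA 1 1 = 1 :=
  ⟨rfl, rfl, rfl, rfl⟩

theorem matB_entries : matB 0 0 = 1 ∧ matB 0 1 = 0 ∧ matB 1 0 = -1 ∧ matB 1 1 = 1 :=
  ⟨rfl, rfl, rfl, rfl⟩

theorem matB_inv_entries :
    matB⁻¹ 0 0 = 1 ∧ matB⁻¹ 0 1 = 0 ∧ matB⁻¹ 1 0 = 1 ∧ matB⁻¹ 1 1 = 1 := by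
  rw [Matrix.SpecialLinearGroup.SL2_inv_expl]
  simp [matB_entries]

theorem matS_eq : matS = matA * matB * matA := by
  ext i j
  fin_cases i <;> fin_cases j <;>
    simp [mul_entry, matS_entries, matA_entries, matB_entries]

theorem matS_mul_matS : matS * matS = -1 := by
  ext i j
  fin_cases i <;> fin_cases j <;> simp [mul_entry, matS_entries]

/-- The rotation `x ↦ -1 / x` in `PSL(2, ℤ)`. -/
def S : PSL(2, ℤ) := QuotientGroup.mk matS

theorem S_eq : S = A * B * A := congrArg QuotientGroup.mk matS_eq

theorem S_mul_S : S * S = 1 := by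
  change (QuotientGroup.mk (matS * matS) : PSL(2, ℤ)) = 1
  rw [matS_mul_matS, mk_neg]
  rfl

/-- All entries of the matrix are nonnegative. -/
def IsNonneg (m : SL(2, ℤ)) : Prop := ∀ i j, 0 ≤ m i j

theorem isNonneg_iff {m : SL(2, ℤ)} :
    IsNonneg m ↔ 0 ≤ m 0 0 ∧ 0 ≤ m 0 1 ∧ 0 ≤ m 1 0 ∧ 0 ≤ m 1 1 := by
  simp [IsNonneg, Fin.forall_fin_two, and_assoc]

/-- By the determinant the off-diagonal entries have product at least 0. If they are nonpositive,
conjugation by `S` swaps the diagonal entries and makes the off-diagonal ones nonnegative. -/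
theorem exists_isNonneg_of_diag_pos {g : SL(2, ℤ)} (h : 0 < g 0 0) (h' : 0 < g 1 1) :
    ∃ (u : PSL(2, ℤ)) (m : SL(2, ℤ)), (u = 1 ∨ u = S) ∧ IsNonneg m ∧
      (QuotientGroup.mk g : PSL(2, ℤ)) = u * QuotientGroup.mk m * u := by
  have hdet := det_eq_one g
  have hbc : 0 ≤ g 0 1 * g 1 0 := by nlinarith
  by_cases h1 : 0 ≤ g 0 1 ∧ 0 ≤ g 1 0
  · exact ⟨1, g, Or.inl rfl, isNonneg_iff.mpr ⟨h.le, h1.1, h1.2, h'.le⟩, by simp⟩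
  · have h2 : g 0 1 ≤ 0 ∧ g 1 0 ≤ 0 := by
      rcases mul_nonneg_iff.mp hbc with h2 | h2
      · exact absurd h2 h1
      · exact h2
    refine ⟨S, -(matS * g * matS), Or.inr rfl, ?_, ?_⟩
    · rw [isNonneg_iff]
      simp only [Matrix.SpecialLinearGroup.coe_neg, Matrix.neg_apply, mul_entry, matS_entries]
      omega
    · rw [mk_neg]
      change _ = S * (S * QuotientGroup.mk g * S) * S
      rw [← mul_assoc, ← mul_assoc, S_mul_S, one_mul, mul_assoc, S_mul_S, mul_one]

theorem exists_isNonneg_of_diag_mul_pos {g : SL(2, ℤ)} (h : 0 < g 0 0 * g 1 1) :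
    ∃ (u : PSL(2, ℤ)) (m : SL(2, ℤ)), (u = 1 ∨ u = S) ∧ IsNonneg m ∧
      (QuotientGroup.mk g : PSL(2, ℤ)) = u * QuotientGroup.mk m * u := by
  rcases mul_pos_iff.mp h with h | h
  · exact exists_isNonneg_of_diag_pos h.1 h.2
  · rw [← mk_neg g]
    exact exists_isNonneg_of_diag_pos (by simpa using h.1) (by simpa using h.2)

theorem exists_isNonneg (g : PSL(2, ℤ)) :
    ∃ (u v : PSL(2, ℤ)) (m : SL(2, ℤ)), (u = 1 ∨ u = S) ∧ (v = 1 ∨ v = S) ∧ IsNonneg m ∧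
      g = u * QuotientGroup.mk m * v := by
  obtain ⟨g, rfl⟩ := QuotientGroup.mk_surjective g
  by_cases h : 0 < g 0 0 * g 1 1
  · obtain ⟨u, m, hu, hm, hg⟩ := exists_isNonneg_of_diag_mul_pos h
    exact ⟨u, u, m, hu, hu, hm, hg⟩
  · have hdet := det_eq_one g
    -- The diagonal product of `g S` is `1` minus that of `g`.
    have h' : 0 < (g * matS) 0 0 * (g * matS) 1 1 := by
      simp only [mul_entry, matS_entries]
      linarith
    obtain ⟨u, m, hu, hm, hg⟩ := exists_isNonneg_of_diag_mul_pos h'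
    refine ⟨u, u * S, m, hu, ?_, hm, ?_⟩
    · rcases hu with rfl | rfl
      · simp
      · simp [S_mul_S]
    · rw [← mul_assoc, ← hg]
      change _ = QuotientGroup.mk g * S * S
      rw [mul_assoc, S_mul_S, mul_one]

/-- Right multiplication by `A` makes the upper right entry positive; `B⁻²` adds twice the upper row
to the lower one. -/
theorem IsNonneg.isContracting {m : SL(2, ℤ)} (hm : IsNonneg m) :
    IsContracting (matB⁻¹ * matB⁻¹ * m * matA) := by
  obtain ⟨h00, h01, h10, h11⟩ := isNonneg_iff.mp hm
  have hdet := det_eq_one m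
  have hpos : 0 < m 0 0 := by
    rcases h00.eq_or_lt with h | h
    · rw [← h] at hdet
      nlinarith [mul_nonneg h01 h10]
    · exact h
  constructor <;>
    simp only [mul_entry, matA_entries, matB_inv_entries] <;> linarith

/-! ### Balls in the Cayley graph -/

open scoped Pointwise
open Classical in
/-- The generators of `PSL(2, ℤ)` together with `1`. -/
noncomputable def generators : Finset PSL(2, ℤ) := {1, A, A⁻¹, B, B⁻¹}

open Classical in
theorem mem_generators {g : PSL(2, ℤ)} :
    g ∈ generators ↔ g = 1 ∨ g ∈ ({A, A⁻¹, B, B⁻¹} : Set PSL(2, ℤ)) := by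
  simp [generators]

open Classical in
theorem card_generators_le : generators.card ≤ 5 := Finset.card_le_five

open Classical in
theorem generators_inv : generators⁻¹ = generators := by
  ext g
  simp only [generators, Finset.mem_inv', Finset.mem_insert, Finset.mem_singleton,
    inv_eq_iff_eq_inv, inv_inv, inv_one]
  tauto

open Classical in
theorem inv_mem_generators_pow {g : PSL(2, ℤ)} {n : ℕ} (hg : g ∈ generators ^ n) :
    g⁻¹ ∈ generators ^ n := by
  rw [← generators_inv, inv_pow]
  exact Finset.inv_mem_inv hg

theorem one_mem_generators : (1 : PSL(2, ℤ)) ∈ generators := mem_generators.mpr (Or.inl rfl)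

open Classical in
theorem inv_mul_mem_generators_pow {x y : PSL(2, ℤ)}
    (w : (SimpleGraph.mulCayley ({A, A⁻¹, B, B⁻¹} : Set PSL(2, ℤ))).Walk x y) :
    x⁻¹ * y ∈ generators ^ w.length := by
  induction w with
  | nil => simp
  | @cons x z y h w ih =>
    rw [SimpleGraph.Walk.length_cons, pow_succ']
    have : x⁻¹ * y = x⁻¹ * z * (z⁻¹ * y) := by group
    rw [this]
    refine Finset.mul_mem_mul ?_ ih
    obtain ⟨-, s, hs, h | h⟩ := (SimpleGraph.mulCayley_adj' _ _ _).mp h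
    · rw [← h, inv_mul_cancel_left]
      exact mem_generators.mpr (Or.inr hs)
    · rw [h, mul_inv_rev, inv_mul_cancel_right, ← generators_inv]
      exact Finset.inv_mem_inv (mem_generators.mpr (Or.inr hs))

-- With `1` among the generators, words of length exactly `l` already represent the whole ball.
open Classical in
theorem cayleyBall_eq (l : ℕ) : cayleyBall l = (generators ^ l : Finset PSL(2, ℤ)) := by
  ext g
  rw [Finset.mem_coe]
  constructor
  · intro h
    have h : SimpleGraph.edist _ 1 g ≤ (l : ℕ∞) := h
    obtain ⟨w, hw⟩ := SimpleGraph.exists_walk_of_edist_ne_top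
      (ne_top_of_le_ne_top (ENat.natCast_ne_top l) h)
    rw [← hw, Nat.cast_le] at h
    have := inv_mul_mem_generators_pow w
    rw [inv_one, one_mul] at this
    exact Finset.pow_subset_pow_right one_mem_generators h this
  · change _ → SimpleGraph.edist _ 1 g ≤ (l : ℕ∞)
    induction l generalizing g with
    | zero =>
      intro h
      have : g = 1 := by simpa using h
      simp [this]
    | succ l ih =>
      rw [pow_succ, Finset.mem_mul]
      rintro ⟨x, hx, s, hs, rfl⟩
      refine (SimpleGraph.edist_triangle (v := x)).trans ?_
      push_cast
      refine add_le_add (ih x hx) ?_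
      rw [SimpleGraph.edist_le_one_iff_adj_or_eq]
      rcases mem_generators.mp hs with rfl | hs
      · simp
      · by_cases hne : x = x * s
        · exact Or.inr hne
        · exact Or.inl ((SimpleGraph.mulCayley_adj' _ _ _).mpr ⟨hne, s, hs, Or.inl rfl⟩)

open Classical in
theorem S_mem_generators_pow : S ∈ generators ^ 3 := by
  have hA : A ∈ generators := mem_generators.mpr (by simp)
  have hB : B ∈ generators := mem_generators.mpr (by simp)
  rw [S_eq, pow_succ, pow_two]
  exact Finset.mul_mem_mul (Finset.mul_mem_mul hA hB) hA

/-! ### ### Counting up to bounded corrections -/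

-- The corrections are `u B²` and `A⁻¹ v`, with `u` and `v` of word length at most 3; hence `5 = 3 +
-- 2`, `4 = 1 + 3` and `9 = 5 + 4`.
open Classical in
theorem exists_loxodromicInBall {l : ℕ} {g : PSL(2, ℤ)} (hg : g ∈ generators ^ l) :
    ∃ u ∈ generators ^ 5, ∃ v ∈ generators ^ 4, ∃ h ∈ loxodromicInBall (l + 9),
      g = u * h * v := by
  obtain ⟨u, v, m, hu, hv, hm, hguv⟩ := exists_isNonneg g
  have hA : A⁻¹ ∈ generators := mem_generators.mpr (by simp)
  have hB : B ∈ generators := mem_generators.mpr (by simp)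
  have hS {w : PSL(2, ℤ)} (hw : w = 1 ∨ w = S) : w ∈ generators ^ 3 := by
    rcases hw with rfl | rfl
    · exact Finset.one_mem_pow one_mem_generators
    · exact S_mem_generators_pow
  have hU : u * B * B ∈ generators ^ 5 := by
    rw [pow_succ, pow_succ]
    exact Finset.mul_mem_mul (Finset.mul_mem_mul (hS hu) hB) hB
  have hV : A⁻¹ * v ∈ generators ^ 4 := by
    rw [pow_succ']
    exact Finset.mul_mem_mul hA (hS hv)
  set h : PSL(2, ℤ) := QuotientGroup.mk (matB⁻¹ * matB⁻¹ * m * matA) with hh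
  have hh' : h = B⁻¹ * B⁻¹ * QuotientGroup.mk m * A := rfl
  have hgh : g = u * B * B * h * (A⁻¹ * v) := by
    rw [hh', hguv]
    group
  have hball : h ∈ cayleyBall (l + 9) := by
    have : h = (u * B * B)⁻¹ * g * (A⁻¹ * v)⁻¹ := by
      rw [hgh]
      group
    rw [cayleyBall_eq, Finset.mem_coe, this, show l + 9 = 5 + l + 4 by ring, pow_add, pow_add]
    exact Finset.mul_mem_mul (Finset.mul_mem_mul (inv_mem_generators_pow hU) hg)
      (inv_mem_generators_pow hV)
  exact ⟨_, hU, _, hV, h, ⟨hball, hm.isContracting.actsLoxodromically,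
    hm.isContracting.axisPassesWithin⟩, hgh⟩

-- One factor `5 ^ 9` counts the correction pairs, the other bounds the growth from radius `l` to `l
-- + 9`.
open Classical in
theorem ncard_cayleyBall_le (l : ℕ) :
    (cayleyBall (l + 9)).ncard ≤ 5 ^ 18 * (loxodromicInBall (l + 9)).ncard := by
  have hfin : (loxodromicInBall (l + 9)).Finite :=
    (cayleyBall_eq (l + 9) ▸ Finset.finite_toSet _ : (cayleyBall (l + 9)).Finite).subset
      fun _ h => h.1
  have hsub : generators ^ l ⊆ generators ^ 5 * hfin.toFinset * generators ^ 4 := by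
    intro g hg
    obtain ⟨u, hu, v, hv, h, hh, rfl⟩ := exists_loxodromicInBall hg
    exact Finset.mul_mem_mul (Finset.mul_mem_mul hu (hfin.mem_toFinset.mpr hh)) hv
  have hpow (n : ℕ) : (generators ^ n).card ≤ 5 ^ n :=
    Finset.card_pow_le.trans (Nat.pow_le_pow_left card_generators_le n)
  rw [cayleyBall_eq, Set.ncard_coe_finset, Set.ncard_eq_toFinset_card _ hfin]
  calc (generators ^ (l + 9)).card
      ≤ (generators ^ l).card * (generators ^ 9).card := by
        rw [pow_add]
        exact Finset.card_mul_le
    _ ≤ ((generators ^ 5).card * hfin.toFinset.card * (generators ^ 4).card) * 5 ^ 9 := by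
        refine Nat.mul_le_mul ?_ (hpow 9)
        exact (Finset.card_le_card hsub).trans
          (Finset.card_mul_le.trans (Nat.mul_le_mul_right _ Finset.card_mul_le))
    _ ≤ (5 ^ 5 * hfin.toFinset.card * 5 ^ 4) * 5 ^ 9 := by
        gcongr
        · exact hpow 5
        · exact hpow 4
    _ = 5 ^ 18 * hfin.toFinset.card := by ring

open Classical in
theorem ncard_cayleyBall_pos (l : ℕ) : 0 < (cayleyBall l).ncard := by
  rw [cayleyBall_eq, Set.ncard_coe_finset]
  exact Finset.card_pos.mpr ⟨1, Finset.one_mem_pow one_mem_generators⟩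

open Classical in
theorem ncard_loxodromicInBall_le (l : ℕ) :
    (loxodromicInBall l).ncard ≤ (cayleyBall l).ncard := by
  refine Set.ncard_le_ncard (fun _ h => h.1) ?_
  rw [cayleyBall_eq]
  exact Finset.finite_toSet _

end FareyPSL

theorem mainTheorem7 :
    0 < Filter.liminf
      (fun l : ℕ => ((FareyPSL.loxodromicInBall l).ncard : ℝ) /
        ((FareyPSL.cayleyBall l).ncard : ℝ)) Filter.atTop := by
  refine lt_of_lt_of_le (b := 1 / 5 ^ 18) (by positivity)
    (Filter.le_liminf_of_le ?_ ?_)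
  -- Coboundedness excludes the default value of a real `liminf`; the ratio is at most 1.
  · refine Filter.IsCoboundedUnder.of_frequently_le (a := 1) (Filter.Frequently.of_forall ?_)
    intro l
    refine div_le_one_of_le₀ ?_ (Nat.cast_nonneg _)
    exact_mod_cast FareyPSL.ncard_loxodromicInBall_le l
  · filter_upwards [Filter.eventually_ge_atTop 9] with l hl
    obtain ⟨k, rfl⟩ := Nat.exists_eq_add_of_le' hl
    have hpos : (0 : ℝ) < (FareyPSL.cayleyBall (k + 9)).ncard := by
      exact_mod_cast FareyPSL.ncard_cayleyBall_pos (k + 9)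
    rw [div_le_div_iff₀ (by positivity) hpos, one_mul, mul_comm]
    exact_mod_cast FareyPSL.ncard_cayleyBall_le k
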